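/- Let $\mathrm{MAlg}(X,\mu)$ denote the measure algebra of a probability space $(X,\mu)$ (measurable sets modulo null sets, with the metric $d_\mu(A,B)=\mu(A\bigtriangleup B)$, the constants $\emptyset,X$, the operations $\cup,\cap,\bigtriangleup$ and the function $\mu$), and let $\mathrm{Aut}(X,\mu)$ be its automorphism group, with the topology of pointwise convergence on $\mathrm{MAlg}(X,\mu)$. Let $\mathbb F_2=\langle a,b\rangle$ be the free group on two generators, let $X=\{0,1\}^{\mathbb N\times\mathbb F_2}$ with the Bernoulli measure $\mu=(\frac12\delta_0+\frac12\delta_1)^{\otimes(\mathbb N\times\mathbb F_2)}$, and for $\gamma\in\mathbb F_2$ let $S_\gamma\in\mathrm{Aut}(X,\mu)$ be the automorphism $A\mapsto\{\gamma\cdot x: x\in A\}$ induced by the Bernoulli shift $(\gamma\cdot x)(n,g)=x(n,\gamma^{-1}g)$. Let $\lambda$ be Lebesgue measure on $[0,1]$. **Theorem.** The measure algebras $\mathrm{MAlg}(X,\mu)$ and $\mathrm{MAlg}([0,1],\lambda)$ are isomorphic. Let $\Phi:\mathrm{MAlg}(X,\mu)\to\mathrm{MAlg}([0,1],\lambda)$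 be any isomorphism and put $T_1=\Phi S_a\Phi^{-1}$, $T_2=\Phi S_b\Phi^{-1}$ in $\mathrm{Aut}([0,1],\lambda)$. Then $T_1,T_2$ freely generate the subgroup $\langle T_1,T_2\rangle\cong\mathbb F_2$, and for every orthogonal representation $\pi:\mathrm{Aut}([0,1],\lambda)\to\mathcal O(\mathcal H)$ on a nonzero real Hilbert space $\mathcal H$ (a homomorphism such that $g\mapsto\pi(g)\xi$ is continuous for each $\xi\in\mathcal H$) which has no nonzero invariant vector, the restriction $\pi_{\restriction\langle T_1,T_2\rangle}$ contains the regular representation of $\Gamma=\langle T_1,T_2\rangle$: there is a linear isometric embedding $U:\ell^2(\Gamma)\to\mathcal H$ with $U(\gamma\cdot f)=\pi(\gamma)U(f)$ for all $\gamma\in\Gamma$ and $f\in\ell^2(\Gamma)$, where $(\gamma\cdot f)(g)=f(\gamma^{-1}g)$ and $\ell^2(\Gamma)$ is real. -/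

import Mathlib

open MeasureTheory Topology
open scoped symmDiff ENNReal

noncomputable section

universe u v w

/-! ### Measure algebras -/

/-- The underlying metric space of the measure algebra of `(X, μ)`: measurable sets with the
distance `μ (A ∆ B)`, where sets at distance zero are identified. -/
abbrev MAlg {X : Type u} [MeasurableSpace X] (μ : Measure X) : Type u :=
  SeparationQuotient (MeasuredSets μ)

namespace MAlg

variable {X : Type u} [MeasurableSpace X] {μ : Measure X}

/-- The class of a measurable set in the measure algebra. -/
def mk (μ : Measure X) (A : Set X) (hA : MeasurableSet A) : MAlg μ :=
  SeparationQuotient.mk (⟨A, hA⟩ : MeasuredSets μ)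

theorem inseparable_iff {A B : MeasuredSets μ} :
    Inseparable A B ↔ (A : Set X) =ᵐ[μ] (B : Set X) := by
  rw [EMetric.inseparable_iff, MeasuredSets.edist_def, measure_symmDiff_eq_zero_iff]

/-- The class of the empty set. -/
def empty : MAlg μ := mk μ ∅ MeasurableSet.empty

/-- The class of the whole space. -/
def full : MAlg μ := mk μ Set.univ MeasurableSet.univ

/-- The operation induced by the union. -/
def union : MAlg μ → MAlg μ → MAlg μ :=
  Quotient.map₂ (fun A B => (⟨A.1 ∪ B.1, A.2.union B.2⟩ : MeasuredSets μ))
    fun _ _ h _ _ h' => inseparable_iff.2 ((inseparable_iff.1 h).union (inseparable_iff.1 h'))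

/-- The operation induced by the intersection. -/
def inter : MAlg μ → MAlg μ → MAlg μ :=
  Quotient.map₂ (fun A B => (⟨A.1 ∩ B.1, A.2.inter B.2⟩ : MeasuredSets μ))
    fun _ _ h _ _ h' => inseparable_iff.2 ((inseparable_iff.1 h).inter (inseparable_iff.1 h'))

/-- The operation induced by the symmetric difference. -/
def symDiff : MAlg μ → MAlg μ → MAlg μ :=
  Quotient.map₂ (fun A B => (⟨A.1 ∆ B.1, A.2.symmDiff B.2⟩ : MeasuredSets μ))
    fun _ _ h _ _ h' => inseparable_iff.2 ((inseparable_iff.1 h).symmDiff (inseparable_iff.1 h'))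

/-- The measure, as a relation on the measure algebra. -/
def meas : MAlg μ → ℝ≥0∞ :=
  Quotient.lift (fun A : MeasuredSets μ => μ A.1)
    fun _ _ h => measure_congr (inseparable_iff.1 h)

end MAlg

/-- An isomorphism of measure algebras, as metric structures: a surjective isometry commuting with
the two constants, the union, the intersection, the symmetric difference and the measure. -/
structure MAlgIso {X : Type u} {Y : Type v} [MeasurableSpace X] [MeasurableSpace Y]
    (μ : Measure X) (ν : Measure Y) extends MAlg μ ≃ᵢ MAlg ν where
  map_empty' : toFun MAlg.empty = MAlg.empty
  map_full' : toFun MAlg.full = MAlg.full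
  map_union' : ∀ A B, toFun (MAlg.union A B) = MAlg.union (toFun A) (toFun B)
  map_inter' : ∀ A B, toFun (MAlg.inter A B) = MAlg.inter (toFun A) (toFun B)
  map_symDiff' : ∀ A B, toFun (MAlg.symDiff A B) = MAlg.symDiff (toFun A) (toFun B)
  meas_map' : ∀ A, MAlg.meas (toFun A) = MAlg.meas A

namespace MAlgIso

variable {X : Type u} {Y : Type v} {Z : Type w} [MeasurableSpace X] [MeasurableSpace Y]
  [MeasurableSpace Z] {μ : Measure X} {ν : Measure Y} {ρ : Measure Z}

instance : FunLike (MAlgIso μ ν) (MAlg μ) (MAlg ν) where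
  coe Φ := Φ.toFun
  coe_injective := by
    rintro ⟨⟨e, _⟩, _⟩ ⟨⟨e', _⟩, _⟩ h
    obtain rfl : e = e' := Equiv.coe_fn_injective h
    rfl

@[ext]
theorem ext {Φ Ψ : MAlgIso μ ν} (h : ∀ A, Φ A = Ψ A) : Φ = Ψ := DFunLike.ext _ _ h

/-- The identity. -/
def refl (μ : Measure X) : MAlgIso μ μ where
  toIsometryEquiv := IsometryEquiv.refl _
  map_empty' := rfl
  map_full' := rfl
  map_union' _ _ := rfl
  map_inter' _ _ := rfl
  map_symDiff' _ _ := rfl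
  meas_map' _ := rfl

/-- The composition `Ψ ∘ Φ`. -/
def trans (Φ : MAlgIso μ ν) (Ψ : MAlgIso ν ρ) : MAlgIso μ ρ where
  toIsometryEquiv := Φ.toIsometryEquiv.trans Ψ.toIsometryEquiv
  map_empty' := (congrArg Ψ.toFun Φ.map_empty').trans Ψ.map_empty'
  map_full' := (congrArg Ψ.toFun Φ.map_full').trans Ψ.map_full'
  map_union' A B := (congrArg Ψ.toFun (Φ.map_union' A B)).trans (Ψ.map_union' _ _)
  map_inter' A B := (congrArg Ψ.toFun (Φ.map_inter' A B)).trans (Ψ.map_inter' _ _)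
  map_symDiff' A B := (congrArg Ψ.toFun (Φ.map_symDiff' A B)).trans (Ψ.map_symDiff' _ _)
  meas_map' A := (Ψ.meas_map' _).trans (Φ.meas_map' A)

/-- The inverse isomorphism. -/
def symm (Φ : MAlgIso μ ν) : MAlgIso ν μ where
  toIsometryEquiv := Φ.toIsometryEquiv.symm
  map_empty' := Φ.toEquiv.symm_apply_eq.2 Φ.map_empty'.symm
  map_full' := Φ.toEquiv.symm_apply_eq.2 Φ.map_full'.symm
  map_union' A B := Φ.toEquiv.symm_apply_eq.2 <| by
    refine Eq.trans ?_ (Φ.map_union' _ _).symm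
    exact congrArg₂ _ (Φ.toEquiv.apply_symm_apply A).symm (Φ.toEquiv.apply_symm_apply B).symm
  map_inter' A B := Φ.toEquiv.symm_apply_eq.2 <| by
    refine Eq.trans ?_ (Φ.map_inter' _ _).symm
    exact congrArg₂ _ (Φ.toEquiv.apply_symm_apply A).symm (Φ.toEquiv.apply_symm_apply B).symm
  map_symDiff' A B := Φ.toEquiv.symm_apply_eq.2 <| by
    refine Eq.trans ?_ (Φ.map_symDiff' _ _).symm
    exact congrArg₂ _ (Φ.toEquiv.apply_symm_apply A).symm (Φ.toEquiv.apply_symm_apply B).symm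
  meas_map' A := (Φ.meas_map' _).symm.trans
    (congrArg MAlg.meas (Φ.toEquiv.apply_symm_apply A))

/-- The isomorphism of measure algebras `A ↦ e(A)` induced by a measure-preserving bimeasurable
bijection `e`. -/
def ofMeasurableEquiv (e : X ≃ᵐ Y) (he : MeasurePreserving e μ ν) : MAlgIso μ ν where
  toFun := Quotient.map
    (fun A => (⟨e '' A.1, e.measurableSet_image.2 A.2⟩ : MeasuredSets ν)) fun A B h => by
      refine EMetric.inseparable_iff.2 (Eq.trans ?_ (EMetric.inseparable_iff.1 h))
      change ν ((e '' A.1) ∆ (e '' B.1)) = μ (A.1 ∆ B.1)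
      rw [← Set.image_symmDiff e.injective, ← he.measure_preimage_equiv, e.preimage_image]
  invFun := Quotient.map
    (fun B => (⟨e ⁻¹' B.1, e.measurable B.2⟩ : MeasuredSets μ)) fun A B h => by
      refine EMetric.inseparable_iff.2 (Eq.trans ?_ (EMetric.inseparable_iff.1 h))
      exact he.measure_preimage_equiv (A.1 ∆ B.1)
  left_inv := by
    rintro ⟨A⟩
    exact congrArg SeparationQuotient.mk (Subtype.ext (e.preimage_image A.1))
  right_inv := by
    rintro ⟨A⟩
    exact congrArg SeparationQuotient.mk (Subtype.ext (e.image_preimage A.1))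
  isometry_toFun := by
    rintro ⟨A⟩ ⟨B⟩
    change ν ((e '' A.1) ∆ (e '' B.1)) = μ (A.1 ∆ B.1)
    rw [← Set.image_symmDiff e.injective, ← he.measure_preimage_equiv, e.preimage_image]
  map_empty' := congrArg SeparationQuotient.mk (Subtype.ext (Set.image_empty e))
  map_full' := congrArg SeparationQuotient.mk
    (Subtype.ext (Set.image_univ_of_surjective e.surjective))
  map_union' := by
    rintro ⟨A⟩ ⟨B⟩
    exact congrArg SeparationQuotient.mk (Subtype.ext (Set.image_union e A.1 B.1))
  map_inter' := by
    rintro ⟨A⟩ ⟨B⟩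
    exact congrArg SeparationQuotient.mk (Subtype.ext (Set.image_inter e.injective))
  map_symDiff' := by
    rintro ⟨A⟩ ⟨B⟩
    exact congrArg SeparationQuotient.mk (Subtype.ext (Set.image_symmDiff e.injective A.1 B.1))
  meas_map' := by
    rintro ⟨A⟩
    change ν (e '' A.1) = μ A.1
    rw [← he.measure_preimage_equiv, e.preimage_image]

end MAlgIso

/-- `Aut(X, μ)`: the group of automorphisms of the measure algebra of `(X, μ)`. -/
abbrev MAut {X : Type u} [MeasurableSpace X] (μ : Measure X) : Type u := MAlgIso μ μ

namespace MAut

variable {X : Type u} {Y : Type v} [MeasurableSpace X] [MeasurableSpace Y]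
  {μ : Measure X} {ν : Measure Y}

/-- The group law is the composition of automorphisms. -/
instance : Group (MAut μ) where
  mul S T := MAlgIso.trans T S
  one := MAlgIso.refl μ
  inv T := T.symm
  mul_assoc _ _ _ := rfl
  one_mul _ := rfl
  mul_one _ := rfl
  inv_mul_cancel T := MAlgIso.ext fun A => T.toEquiv.symm_apply_apply A

/-- The topology of pointwise convergence on the measure algebra. -/
instance : TopologicalSpace (MAut μ) :=
  TopologicalSpace.induced (fun (T : MAut μ) (A : MAlg μ) => T A) inferInstance

/-- Transport of automorphisms along an isomorphism of measure algebras: `Φ ∘ T ∘ Φ⁻¹`. -/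
def conj (Φ : MAlgIso μ ν) (T : MAut μ) : MAut ν := (Φ.symm.trans T).trans Φ

end MAut

/-! ### The Bernoulli shift of the free group on two generators -/

/-- The free group on two generators. -/
abbrev F2 : Type := FreeGroup (Fin 2)

/-- The uniform measure `(δ₀ + δ₁) / 2` on `{0, 1}`. -/
def coin : Measure Bool :=
  (2⁻¹ : ℝ≥0∞) • Measure.dirac false + (2⁻¹ : ℝ≥0∞) • Measure.dirac true

instance : IsProbabilityMeasure coin := ⟨by simp [coin, ENNReal.inv_two_add_inv_two]⟩

/-- The space `{0, 1}^(ℕ × F₂)`. -/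
abbrev BSpace : Type := ℕ × F2 → Bool

/-- The Bernoulli measure on `{0, 1}^(ℕ × F₂)`. -/
def bernoulliMeas : Measure BSpace := Measure.infinitePi fun _ => coin

/-- The shift `(γ • x) (n, g) = x (n, γ⁻¹ g)`. -/
def shift (γ : F2) : BSpace ≃ᵐ BSpace where
  toFun x p := x (p.1, γ⁻¹ * p.2)
  invFun x p := x (p.1, γ * p.2)
  left_inv x := by simp
  right_inv x := by simp
  measurable_toFun := measurable_pi_iff.2 fun p => measurable_pi_apply (p.1, γ⁻¹ * p.2)
  measurable_invFun := measurable_pi_iff.2 fun p => measurable_pi_apply (p.1, γ * p.2)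

theorem measurePreserving_shift (γ : F2) :
    MeasurePreserving (shift γ) bernoulliMeas bernoulliMeas := by
  refine ⟨(shift γ).measurable, ?_⟩
  let e : ℕ × F2 ≃ ℕ × F2 := (Equiv.refl ℕ).prodCongr (Equiv.mulLeft γ)
  have h : ⇑(shift γ) = MeasurableEquiv.piCongrLeft (fun _ => Bool) e := by
    refine funext fun x => funext fun p => ?_
    obtain ⟨q, rfl⟩ := e.surjective p
    rw [MeasurableEquiv.coe_piCongrLeft, Equiv.piCongrLeft_apply_apply]
    exact congrArg x (Prod.ext rfl (inv_mul_cancel_left γ q.2))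
  rw [h]
  exact Measure.infinitePi_map_piCongrLeft (fun _ => coin) e

/-- The automorphism of the measure algebra of the Bernoulli space given by the shift by `γ`. -/
def shiftAut (γ : F2) : MAut bernoulliMeas :=
  MAlgIso.ofMeasurableEquiv (shift γ) (measurePreserving_shift γ)

/-! ### Orthogonal representations -/

/-- An orthogonal representation of a topological group on a real Hilbert space: a homomorphism
to the orthogonal group, continuous for the topology of pointwise convergence. -/
structure OrthRep (G : Type u) [Group G] [TopologicalSpace G] (H : Type v)
    [NormedAddCommGroup H] [InnerProductSpace ℝ H] where
  toHom : G →* (H ≃ₗᵢ[ℝ] H)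
  continuous_apply : ∀ ξ : H, Continuous fun g => toHom g ξ

/-- The representation has a (nonzero) invariant vector. -/
def OrthRep.HasInvariantVector {G : Type u} [Group G] [TopologicalSpace G] {H : Type v}
    [NormedAddCommGroup H] [InnerProductSpace ℝ H] (π : OrthRep G H) : Prop :=
  ∃ ξ : H, ξ ≠ 0 ∧ ∀ g, π.toHom g ξ = ξ

/-- The real Hilbert space `ℓ²(Γ)`. -/
abbrev ell2 (Γ : Type u) : Type u := lp (fun _ : Γ => ℝ) 2

/-- Left translation on `ℓ²(Γ)`: `(γ f) (g) = f (γ⁻¹ g)`. -/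
def ell2Translate {Γ : Type u} [Group Γ] (γ : Γ) (f : ell2 Γ) : ell2 Γ :=
  ⟨fun g => f (γ⁻¹ * g), by
    have h := (memℓp_gen_iff (by norm_num)).1 (lp.memℓp f)
    exact (memℓp_gen_iff (by norm_num)).2 ((Equiv.mulLeft γ⁻¹).summable_iff.2 h)⟩

theorem ell2Translate_apply {Γ : Type u} [Group Γ] (γ : Γ) (f : ell2 Γ) (g : Γ) :
    ell2Translate γ f g = f (γ⁻¹ * g) := rfl

/-- The regular representation of a (discrete) group `Γ` on `ℓ²(Γ)`. -/
def regularRep (Γ : Type u) [Group Γ] : Γ →* (ell2 Γ ≃ₗᵢ[ℝ] ell2 Γ) where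
  toFun γ :=
    { toFun := ell2Translate γ
      invFun := ell2Translate γ⁻¹
      map_add' := fun _ _ => rfl
      map_smul' := fun _ _ => rfl
      left_inv := fun f => lp.ext (funext fun g => by simp [ell2Translate_apply])
      right_inv := fun f => lp.ext (funext fun g => by simp [ell2Translate_apply])
      norm_map' := fun f => by
        change ‖ell2Translate γ f‖ = ‖f‖
        rw [lp.norm_eq_tsum_rpow (by norm_num), lp.norm_eq_tsum_rpow (by norm_num)]
        congr 1
        exact (Equiv.mulLeft γ⁻¹).tsum_eq fun g => ‖f g‖ ^ (2 : ℝ≥0∞).toReal }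
  map_one' := by
    refine LinearIsometryEquiv.ext fun f => lp.ext (funext fun g => ?_)
    change f (1⁻¹ * g) = f g
    simp
  map_mul' γ δ := by
    refine LinearIsometryEquiv.ext fun f => lp.ext (funext fun g => ?_)
    change f ((γ * δ)⁻¹ * g) = f (δ⁻¹ * (γ⁻¹ * g))
    simp [mul_assoc]

/-- The representation `π` contains (a copy of) the representation `σ`: there is an equivariant
linear isometric embedding. -/
def ContainsRep {Γ : Type u} [Group Γ] {H : Type v} {K : Type w}
    [NormedAddCommGroup H] [InnerProductSpace ℝ H] [NormedAddCommGroup K] [InnerProductSpace ℝ K]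
    (π : Γ →* (H ≃ₗᵢ[ℝ] H)) (σ : Γ →* (K ≃ₗᵢ[ℝ] K)) : Prop :=
  ∃ U : K →ₗᵢ[ℝ] H, ∀ γ f, U (σ γ f) = π γ (U f)

end

noncomputable section

universe u v w

/-! ### Generalities on measure algebras -/

namespace MAlg

variable {X : Type u} [MeasurableSpace X] {μ : Measure X}

/-! Conjugation by an isomorphism of measure algebras is a continuous isomorphism of automorphism
groups, so everything can be done on the Bernoulli side; the isomorphism with the unit interval
comes from a Borel embedding into the line followed by a distribution function.

Let `G` be the automorphism group of the Bernoulli measure algebra and, for a finite set `F` of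
coordinates, let `G_F` be the subgroup fixing the coordinate classes of `F`. Three facts carry the
proof. Nonzero vectors fixed by some `G_F` exist (`exists_isFixedBy`): by continuity the orbit of a
vector under a suitable `G_F` stays away from `0`, and the point of least norm in its closed convex
hull is fixed. Automorphisms fixing all but finitely many coordinate classes are dense
(`dense_localAut`). Finally, if `E` and `F` are disjoint, vectors fixed by `G_E` and `G_F` are
orthogonal (`IsFixedBy.inner_eq_zero`): permutations fixing `E` push `F` to infinity without
changing the inner product, and a weak limit of the moved vectors is invariant by density, hence
zero.

The factor `ℕ` leaves room to permute a finite `F` into the fibre over `1`. Its translates by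
distinct elements of the free group are then disjoint, so a normalized vector fixed by `G_F` has an
orthonormal orbit, which spans a copy of the regular representation. -/

theorem mk_eq_mk {A B : Set X} {hA : MeasurableSet A} {hB : MeasurableSet B} :
    mk μ A hA = mk μ B hB ↔ A =ᵐ[μ] B :=
  SeparationQuotient.mk_eq_mk.trans inseparable_iff

theorem exists_mk (b : MAlg μ) : ∃ A, ∃ hA : MeasurableSet A, b = mk μ A hA := by
  obtain ⟨A, rfl⟩ := SeparationQuotient.surjective_mk b
  exact ⟨A.1, A.2, rfl⟩

theorem edist_mk {A B : Set X} {hA : MeasurableSet A} {hB : MeasurableSet B} :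
    edist (mk μ A hA) (mk μ B hB) = μ (A ∆ B) :=
  SeparationQuotient.edist_mk _ _

theorem union_mk {A B : Set X} {hA : MeasurableSet A} {hB : MeasurableSet B} :
    union (mk μ A hA) (mk μ B hB) = mk μ (A ∪ B) (hA.union hB) := rfl

theorem inter_mk {A B : Set X} {hA : MeasurableSet A} {hB : MeasurableSet B} :
    inter (mk μ A hA) (mk μ B hB) = mk μ (A ∩ B) (hA.inter hB) := rfl

theorem symDiff_full_mk {A : Set X} {hA : MeasurableSet A} :
    symDiff (mk μ A hA) full = mk μ Aᶜ hA.compl :=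
  congrArg SeparationQuotient.mk (Subtype.ext (symmDiff_top A))

theorem edist_union_le (a b c d : MAlg μ) :
    edist (union a b) (union c d) ≤ edist a c + edist b d := by
  obtain ⟨A, hA, rfl⟩ := exists_mk a
  obtain ⟨B, hB, rfl⟩ := exists_mk b
  obtain ⟨C, hC, rfl⟩ := exists_mk c
  obtain ⟨D, hD, rfl⟩ := exists_mk d
  rw [union_mk, union_mk, edist_mk, edist_mk, edist_mk]
  refine (measure_mono ?_).trans (measure_union_le (A ∆ C) (B ∆ D))
  intro x hx
  simp only [Set.mem_symmDiff, Set.mem_union] at hx ⊢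
  tauto

theorem edist_symDiff_full (a c : MAlg μ) :
    edist (symDiff a full) (symDiff c full) = edist a c := by
  obtain ⟨A, hA, rfl⟩ := exists_mk a
  obtain ⟨C, hC, rfl⟩ := exists_mk c
  rw [symDiff_full_mk, symDiff_full_mk, edist_mk, edist_mk, compl_symmDiff_compl]

/-- A closed set of classes which contains the classes of a family of sets generating the
`σ`-algebra and is stable under union and complement is everything. -/
theorem mem_of_isClosed_of_generateFrom {Z : Type u} [hZ : MeasurableSpace Z] {μ : Measure Z}
    [IsFiniteMeasure μ] {𝒢 : Set (Set Z)}
    (h𝒢 : hZ = MeasurableSpace.generateFrom 𝒢) {S : Set (MAlg μ)} (hS : IsClosed S)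
    (hgen : ∀ A ∈ 𝒢, ∀ hA : MeasurableSet A, mk μ A hA ∈ S) (hempty : empty ∈ S)
    (hunion : ∀ a ∈ S, ∀ b ∈ S, union a b ∈ S) (hcompl : ∀ a ∈ S, symDiff a full ∈ S)
    (b : MAlg μ) : b ∈ S := by
  obtain ⟨B, hB, rfl⟩ := exists_mk b
  -- The sets with class in `S` form a ring generating the `σ`-algebra, so they approximate `B` in
  -- measure; closedness of `S` concludes.
  let C : Set (Set Z) := {A | ∃ hA : MeasurableSet A, mk μ A hA ∈ S}
  have hC1 : ∀ A ∈ C, Aᶜ ∈ C := fun A ⟨hA, h⟩ => ⟨hA.compl, symDiff_full_mk (hA := hA) ▸ hcompl _ h⟩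
  have hC2 : ∀ A ∈ C, ∀ B ∈ C, A ∪ B ∈ C := fun A ⟨hA, h⟩ B ⟨hB, h'⟩ =>
    ⟨hA.union hB, hunion _ h _ h'⟩
  have hC0 : ∅ ∈ C := ⟨MeasurableSet.empty, hempty⟩
  have hCring : IsSetRing C := by
    refine ⟨hC0, fun s t hs ht => hC2 _ hs _ ht, fun s t hs ht => ?_⟩
    have : s \ t = (sᶜ ∪ t)ᶜ := by ext x; simp
    rw [this]
    exact hC1 _ (hC2 _ (hC1 _ hs) _ ht)
  have hCgen : hZ = MeasurableSpace.generateFrom C := by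
    refine le_antisymm ?_ (MeasurableSpace.generateFrom_le fun A hA => hA.1)
    conv_lhs => rw [h𝒢]
    refine MeasurableSpace.generateFrom_mono fun A hA => ?_
    have hA' : MeasurableSet A := by
      rw [h𝒢]; exact MeasurableSpace.measurableSet_generateFrom hA
    exact ⟨hA', hgen A hA hA'⟩
  have hcov : ∃ D : Set (Set Z), D.Countable ∧ D ⊆ C ∧ μ (⋃₀ D)ᶜ = 0 :=
    ⟨{Set.univ}, Set.countable_singleton _,
      Set.singleton_subset_iff.2 (by simpa using hC1 _ hC0), by simp⟩
  refine hS.closure_subset (EMetric.mem_closure_iff.2 fun ε hε => ?_)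
  obtain ⟨t, ⟨ht, htS⟩, h⟩ :=
    exists_measure_symmDiff_lt_of_generateFrom_isSetRing (μ := μ) hCring hcov hCgen hB hε
  exact ⟨_, htS, by rwa [edist_comm, edist_mk]⟩

end MAlg

namespace MAlgIso

variable {X : Type u} {Y : Type v} [MeasurableSpace X] [MeasurableSpace Y]
  {μ : Measure X} {ν : Measure Y}

theorem edist_map (Φ : MAlgIso μ ν) (a b : MAlg μ) : edist (Φ a) (Φ b) = edist a b :=
  Φ.isometry_toFun a b

theorem continuous (Φ : MAlgIso μ ν) : Continuous Φ := Φ.isometry_toFun.continuous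

theorem map_empty (Φ : MAlgIso μ ν) : Φ MAlg.empty = MAlg.empty := Φ.map_empty'

theorem map_full (Φ : MAlgIso μ ν) : Φ MAlg.full = MAlg.full := Φ.map_full'

theorem map_union (Φ : MAlgIso μ ν) (a b : MAlg μ) :
    Φ (MAlg.union a b) = MAlg.union (Φ a) (Φ b) := Φ.map_union' a b

theorem map_inter (Φ : MAlgIso μ ν) (a b : MAlg μ) :
    Φ (MAlg.inter a b) = MAlg.inter (Φ a) (Φ b) := Φ.map_inter' a b

theorem map_symDiff (Φ : MAlgIso μ ν) (a b : MAlg μ) :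
    Φ (MAlg.symDiff a b) = MAlg.symDiff (Φ a) (Φ b) := Φ.map_symDiff' a b

theorem meas_map (Φ : MAlgIso μ ν) (a : MAlg μ) : MAlg.meas (Φ a) = MAlg.meas a := Φ.meas_map' a

theorem symm_apply_apply (Φ : MAlgIso μ ν) (a : MAlg μ) : Φ.symm (Φ a) = a :=
  Φ.toEquiv.symm_apply_apply a

theorem apply_symm_apply (Φ : MAlgIso μ ν) (a : MAlg ν) : Φ (Φ.symm a) = a :=
  Φ.toEquiv.apply_symm_apply a

/-- A measure-preserving map such that every measurable set is a preimage up to a null set induces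
an isomorphism of measure algebras. -/
def ofPreimage (f : X → Y) (hf : MeasurePreserving f μ ν)
    (hsurj : ∀ A, MeasurableSet A → ∃ B, MeasurableSet B ∧ A =ᵐ[μ] f ⁻¹' B) :
    MAlgIso ν μ :=
  let F : MAlg ν → MAlg μ := Quotient.map
    (fun A => (⟨f ⁻¹' A.1, hf.measurable A.2⟩ : MeasuredSets μ)) fun A B h => by
      refine EMetric.inseparable_iff.2 (Eq.trans ?_ (EMetric.inseparable_iff.1 h))
      exact hf.measure_preimage (A.2.symmDiff B.2).nullMeasurableSet
  have hF : Isometry F := by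
    rintro ⟨A⟩ ⟨B⟩
    exact hf.measure_preimage (A.2.symmDiff B.2).nullMeasurableSet
  have hF' : Function.Surjective F := fun a => by
    obtain ⟨A, hA, rfl⟩ := MAlg.exists_mk a
    obtain ⟨B, hB, hAB⟩ := hsurj A hA
    exact ⟨MAlg.mk ν B hB, (MAlg.mk_eq_mk.2 hAB).symm⟩
  { toEquiv := Equiv.ofBijective F ⟨hF.injective, hF'⟩
    isometry_toFun := hF
    map_empty' := rfl
    map_full' := rfl
    map_union' := by rintro ⟨A⟩ ⟨B⟩; rfl
    map_inter' := by rintro ⟨A⟩ ⟨B⟩; rfl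
    map_symDiff' := by rintro ⟨A⟩ ⟨B⟩; rfl
    meas_map' := by
      rintro ⟨A⟩
      exact hf.measure_preimage A.2.nullMeasurableSet }

end MAlgIso

namespace MAut

variable {X : Type u} {Y : Type v} [MeasurableSpace X] [MeasurableSpace Y]
  {μ : Measure X} {ν : Measure Y}

theorem mul_apply (S T : MAut μ) (a : MAlg μ) : (S * T) a = S (T a) := rfl

theorem one_apply (a : MAlg μ) : (1 : MAut μ) a = a := rfl

theorem inv_apply_apply (T : MAut μ) (a : MAlg μ) : T⁻¹ (T a) = a := T.symm_apply_apply a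

/-- The isomorphism of groups `T ↦ Φ ∘ T ∘ Φ⁻¹`. -/
def conjEquiv (Φ : MAlgIso μ ν) : MAut μ ≃* MAut ν where
  toFun := conj Φ
  invFun := conj Φ.symm
  left_inv T := MAlgIso.ext fun a => by
    change Φ.symm (Φ (T (Φ.symm (Φ a)))) = T a
    rw [Φ.symm_apply_apply, Φ.symm_apply_apply]
  right_inv T := MAlgIso.ext fun a => by
    change Φ (Φ.symm (T (Φ (Φ.symm a)))) = T a
    rw [Φ.apply_symm_apply, Φ.apply_symm_apply]
  map_mul' S T := MAlgIso.ext fun a => by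
    change Φ (S (T (Φ.symm a))) = Φ (S (Φ.symm (Φ (T (Φ.symm a)))))
    rw [Φ.symm_apply_apply]

theorem continuous_apply (a : MAlg μ) : Continuous fun T : MAut μ => T a :=
  (_root_.continuous_apply a).comp continuous_induced_dom

theorem continuous_conjEquiv (Φ : MAlgIso μ ν) : Continuous (conjEquiv Φ) :=
  continuous_induced_rng.2 <| continuous_pi fun a =>
    Φ.continuous.comp (continuous_apply (Φ.symm a))

/-- Convergence of automorphisms may be tested on the classes of a family of sets generating the
`σ`-algebra. -/
theorem le_nhds_of_tendsto {Z : Type u} [hZ : MeasurableSpace Z] {μ : Measure Z} [IsFiniteMeasure μ]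
    {𝒢 : Set (Set Z)} (h𝒢 : hZ = MeasurableSpace.generateFrom 𝒢) {l : Filter (MAut μ)} {g : MAut μ}
    (h : ∀ A ∈ 𝒢, ∀ hA : MeasurableSet A,
      Filter.Tendsto (fun T : MAut μ => T (MAlg.mk μ A hA)) l (𝓝 (g (MAlg.mk μ A hA)))) :
    l ≤ 𝓝 g := by
  rw [nhds_induced, ← Filter.tendsto_iff_comap, tendsto_pi_nhds]
  refine MAlg.mem_of_isClosed_of_generateFrom (S := {b | Filter.Tendsto (fun T : MAut μ => T b) l
    (𝓝 (g b))}) h𝒢 ?_ h ?_ ?_ ?_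
  -- Automorphisms are isometries, so replacing `b` by a nearby class `c` costs an error independent
  -- of `T`.
  · refine isClosed_of_closure_subset fun b hb => EMetric.tendsto_nhds.2 fun ε hε => ?_
    have hε' : 0 < ε / 3 := ENNReal.div_pos hε.ne' (by norm_num)
    obtain ⟨c, hc, hbc⟩ := EMetric.mem_closure_iff.1 hb _ hε'
    filter_upwards [EMetric.tendsto_nhds.1 hc _ hε'] with T hT
    calc edist (T b) (g b) ≤ edist (T b) (T c) + edist (T c) (g c) + edist (g c) (g b) :=
          (edist_triangle _ (g c) _).trans (add_le_add_left (edist_triangle _ _ _) _)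
      _ < ε / 3 + ε / 3 + ε / 3 := by
          rw [T.edist_map, g.edist_map, edist_comm c b]
          exact ENNReal.add_lt_add (ENNReal.add_lt_add hbc hT) hbc
      _ = ε := ENNReal.add_thirds ε
  · simpa only [Set.mem_ofPred_eq, MAlgIso.map_empty] using tendsto_const_nhds
  · intro a ha b hb
    refine EMetric.tendsto_nhds.2 fun ε hε => ?_
    have hε' : 0 < ε / 2 := ENNReal.half_pos hε.ne'
    filter_upwards [EMetric.tendsto_nhds.1 ha _ hε', EMetric.tendsto_nhds.1 hb _ hε'] with T h1 h2
    rw [MAlgIso.map_union, MAlgIso.map_union]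
    refine (MAlg.edist_union_le _ _ _ _).trans_lt ?_
    exact (ENNReal.add_lt_add h1 h2).trans_eq (ENNReal.add_halves ε)
  · intro a ha
    refine EMetric.tendsto_nhds.2 fun ε hε => ?_
    filter_upwards [EMetric.tendsto_nhds.1 ha _ hε] with T hT
    rwa [MAlgIso.map_symDiff, MAlgIso.map_symDiff, MAlgIso.map_full, MAlgIso.map_full,
      MAlg.edist_symDiff_full]

end MAut

/-! ### The Bernoulli space and the unit interval -/

open ProbabilityTheory in
/-- The distribution function of a probability measure on the line, as a map to the unit
interval. -/
def cdfI (ν : Measure ℝ) (t : ℝ) : unitInterval := ⟨cdf ν t, cdf_nonneg ν t, cdf_le_one ν t⟩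

section cdfI

open ProbabilityTheory

theorem monotone_cdfI (ν : Measure ℝ) : Monotone (cdfI ν) := fun _ _ h => monotone_cdf ν h

variable (ν : Measure ℝ) [IsProbabilityMeasure ν]

/-- The distribution function is right continuous and its jump at a point is the mass of that point.
-/
theorem continuous_cdf [NullSingletonClass ν] : Continuous (cdf ν) := by
  refine continuous_iff_continuousAt.2 fun t => ?_
  rw [(monotone_cdf ν).continuousAt_iff_leftLim_eq_rightLim, StieltjesFunction.rightLim_eq]
  have h : ν {t} = 0 := measure_singleton t
  rw [← measure_cdf ν, StieltjesFunction.measure_singleton, ENNReal.ofReal_eq_zero] at h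
  exact le_antisymm ((monotone_cdf ν).leftLim_le le_rfl) (by linarith)

/-- For `u < 1` a nonempty sublevel set is bounded above, hence a closed half-line `Iic t` by
monotonicity and continuity. To the right of `t` the values exceed `u`, so the value at `t` is
exactly `u`. -/
theorem measure_cdf_le [NullSingletonClass ν] {u : ℝ} (h0 : 0 ≤ u) (h1 : u ≤ 1) :
    ν {t | cdf ν t ≤ u} = ENNReal.ofReal u := by
  rcases h1.eq_or_lt with rfl | h1
  · simp [cdf_le_one]
  rcases Set.eq_empty_or_nonempty {t | cdf ν t ≤ u} with he | hne
  · rcases h0.eq_or_lt with rfl | h0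
    · rw [he]; simp
    · obtain ⟨t, ht⟩ := ((tendsto_cdf_atBot ν).eventually_lt_const h0).exists
      exact absurd (show t ∈ {t | cdf ν t ≤ u} from ht.le) (he ▸ Set.notMem_empty t)
  · obtain ⟨s, hs⟩ := ((tendsto_cdf_atTop ν).eventually_const_lt h1).exists
    have hb : BddAbove {t | cdf ν t ≤ u} :=
      ⟨s, fun t ht => le_of_lt ((monotone_cdf ν).reflect_lt (lt_of_le_of_lt ht hs))⟩
    have hcl : IsClosed {t | cdf ν t ≤ u} := isClosed_le (continuous_cdf ν) continuous_const
    have hmem := hcl.csSup_mem hne hb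
    set t := sSup {t | cdf ν t ≤ u} with ht
    have heq : {t | cdf ν t ≤ u} = Set.Iic t :=
      Set.Subset.antisymm (fun r hr => le_csSup hb hr)
        (fun r hr => (monotone_cdf ν hr).trans hmem)
    have hge : u ≤ cdf ν t := by
      refine ge_of_tendsto (((continuous_cdf ν).tendsto t).mono_left
        (nhdsWithin_le_nhds (s := Set.Ioi t))) ?_
      filter_upwards [self_mem_nhdsWithin] with r hr
      by_contra! h
      exact absurd (le_csSup hb (show r ∈ {t | cdf ν t ≤ u} from h.le)) (not_le.2 hr)
    rw [heq, ← ofReal_cdf, le_antisymm hmem hge]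

theorem measurePreserving_cdfI [NullSingletonClass ν] :
    MeasurePreserving (cdfI ν) ν (volume : Measure unitInterval) := by
  have hm : Measurable (cdfI ν) := (monotone_cdfI ν).measurable
  refine ⟨hm, ?_⟩
  have : IsProbabilityMeasure (ν.map (cdfI ν)) := Measure.isProbabilityMeasure_map hm.aemeasurable
  refine Measure.ext_of_Iic _ _ fun u => ?_
  rw [Measure.map_apply hm measurableSet_Iic, unitInterval.volume_Iic]
  exact measure_cdf_le ν u.2.1 u.2.2

/-- The distribution function need not be injective, but it only collapses null sets: `Iic t` lies
in the preimage of `Iic (cdfI ν t)`, and both have the same measure. The sets with the property form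
a `σ`-algebra. -/
theorem exists_ae_eq_preimage_cdfI [NullSingletonClass ν] {A : Set ℝ} (hA : MeasurableSet A) :
    ∃ B, MeasurableSet B ∧ A =ᵐ[ν] cdfI ν ⁻¹' B := by
  have hA' : @MeasurableSet _ (MeasurableSpace.generateFrom (Set.range Set.Iic)) A := by
    rw [← borel_eq_generateFrom_Iic, ← BorelSpace.measurable_eq]; exact hA
  induction A, hA' using MeasurableSpace.generateFrom_induction with
  | hC A hAC _ =>
    obtain ⟨t, rfl⟩ := hAC
    refine ⟨Set.Iic (cdfI ν t), measurableSet_Iic, ?_⟩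
    refine ae_eq_of_subset_of_measure_ge (fun s hs => monotone_cdfI ν hs) ?_
      measurableSet_Iic.nullMeasurableSet (measure_ne_top _ _)
    rw [← ofReal_cdf]
    exact (measure_cdf_le ν (cdf_nonneg ν t) (cdf_le_one ν t)).le
  | empty => exact ⟨∅, MeasurableSet.empty, by simp⟩
  | compl A hA ih =>
    obtain ⟨B, hB, h⟩ := ih (by simpa using hA)
    exact ⟨Bᶜ, hB.compl, h.compl⟩
  | iUnion s hs ih =>
    have hs' : ∀ n, MeasurableSet (s n) := fun n => by
      rw [BorelSpace.measurable_eq (α := ℝ), borel_eq_generateFrom_Iic]; exact hs n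
    choose B hB h using fun n => ih n (hs' n)
    refine ⟨⋃ n, B n, MeasurableSet.iUnion hB, ?_⟩
    rw [Set.preimage_iUnion]
    exact Filter.EventuallyEq.countable_iUnion h

end cdfI

/-- The measure algebra of an atomless standard Borel probability space is isomorphic to that of
the unit interval. -/
theorem nonempty_malgIso_unitInterval {X : Type u} [MeasurableSpace X] [StandardBorelSpace X]
    (μ : Measure X) [IsProbabilityMeasure μ] [NullSingletonClass μ] :
    Nonempty (MAlgIso μ (volume : Measure unitInterval)) := by
  have hp := measurableEmbedding_embeddingReal X
  set p := embeddingReal X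
  have hν : IsProbabilityMeasure (μ.map p) :=
    Measure.isProbabilityMeasure_map hp.measurable.aemeasurable
  have hν' : NullSingletonClass (μ.map p) := ⟨fun t => by
    rw [hp.map_apply]
    exact (Set.subsingleton_singleton.preimage hp.injective).measure_zero μ⟩
  refine ⟨(MAlgIso.ofPreimage (cdfI (μ.map p) ∘ p)
    ((measurePreserving_cdfI (μ.map p)).comp ⟨hp.measurable, rfl⟩) fun A hA => ?_).symm⟩
  obtain ⟨B, hB, h⟩ := exists_ae_eq_preimage_cdfI (μ.map p) (hp.measurableSet_image.2 hA)
  refine ⟨B, hB, ?_⟩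
  have := (Measure.QuasiMeasurePreserving.mk hp.measurable
    Measure.AbsolutelyContinuous.rfl).preimage_ae_eq h
  rwa [hp.injective.preimage_image] at this

theorem coin_singleton (b : Bool) : coin {b} = 2⁻¹ := by
  cases b <;> simp [coin]

instance : IsProbabilityMeasure bernoulliMeas := by unfold bernoulliMeas; infer_instance

theorem bernoulliMeas_eq_on (D : Finset (ℕ × F2)) (y : BSpace) :
    bernoulliMeas {x | ∀ i ∈ D, x i = y i} = 2⁻¹ ^ D.card := by
  have h : {x : BSpace | ∀ i ∈ D, x i = y i} = (D : Set (ℕ × F2)).pi fun i => {y i} := by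
    ext x; simp [Set.mem_pi]
  rw [h, bernoulliMeas, Measure.infinitePi_pi _ fun i _ => measurableSet_singleton _]
  simp [coin_singleton]

/-- A point lies in cylinders of measure `2⁻¹ ^ n` for every `n`. -/
instance : NullSingletonClass bernoulliMeas := ⟨fun y => by
  refine le_antisymm (ge_of_tendsto' (ENNReal.tendsto_pow_atTop_nhds_zero_of_lt_one
    (r := 2⁻¹) (by simp)) fun n => ?_) bot_le
  obtain ⟨D, rfl⟩ := Infinite.exists_subset_card_eq (ℕ × F2) n
  rw [← bernoulliMeas_eq_on D y]
  exact measure_mono fun x hx i _ => by rw [Set.mem_singleton_iff.1 hx]⟩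

/-! ### Coordinate sets and automorphisms of the Bernoulli space -/

theorem measurableSet_coord (i : ℕ × F2) : MeasurableSet {x : BSpace | x i = true} :=
  (measurable_pi_apply (X := fun _ : ℕ × F2 => Bool) i) (measurableSet_singleton true)

/-- The class of the set of points whose coordinate at `i` is `true`. -/
def coordCls (i : ℕ × F2) : MAlg bernoulliMeas :=
  MAlg.mk bernoulliMeas {x | x i = true} (measurableSet_coord i)

theorem generateFrom_coord : (inferInstance : MeasurableSpace BSpace) =
    MeasurableSpace.generateFrom (Set.range fun i : ℕ × F2 => {x : BSpace | x i = true}) := by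
  refine le_antisymm (iSup_le fun i => ?_) (MeasurableSpace.generateFrom_le ?_)
  · refine (measurable_iff_comap_le (f := fun x : BSpace => x i)).1 (measurable_to_bool ?_)
    exact MeasurableSpace.measurableSet_generateFrom ⟨i, rfl⟩
  · rintro _ ⟨i, rfl⟩
    exact measurableSet_coord i

theorem le_nhds_of_tendsto_coordCls {l : Filter (MAut bernoulliMeas)} {g : MAut bernoulliMeas}
    (h : ∀ i, Filter.Tendsto (fun T : MAut bernoulliMeas => T (coordCls i)) l
      (𝓝 (g (coordCls i)))) : l ≤ 𝓝 g := by
  refine MAut.le_nhds_of_tendsto generateFrom_coord ?_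
  rintro _ ⟨i, rfl⟩ _
  exact h i

/-- A neighbourhood of an automorphism contains all automorphisms that are close to it on finitely
many coordinate classes. -/
theorem exists_forall_edist_lt_mem {g : MAut bernoulliMeas} {s : Set (MAut bernoulliMeas)}
    (hs : s ∈ 𝓝 g) : ∃ D : Finset (ℕ × F2), ∃ ε > 0, ∀ h : MAut bernoulliMeas,
      (∀ i ∈ D, edist (h (coordCls i)) (g (coordCls i)) < ε) → h ∈ s := by
  -- The coordinate classes alone determine the neighbourhoods of `g`, so finitely many of them
  -- suffice below.
  have hl : (Filter.pi fun i => 𝓝 (g (coordCls i))).comap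
      (fun (T : MAut bernoulliMeas) i => T (coordCls i)) ≤ 𝓝 g :=
    le_nhds_of_tendsto_coordCls fun i =>
      (Filter.tendsto_eval_pi (fun i => 𝓝 (g (coordCls i))) i).comp Filter.tendsto_comap
  obtain ⟨t, ht, hts⟩ := Filter.mem_comap.1 (hl hs)
  obtain ⟨I, hI, u, hu, hut⟩ := Filter.mem_pi.1 ht
  choose δ hδ hδu using fun i => EMetric.mem_nhds_iff.1 (hu i)
  -- If no coordinate is involved the infimum is `⊤`, which is still positive.
  refine ⟨hI.toFinset, hI.toFinset.inf δ, ?_, fun h hh => hts (hut fun i hi => hδu i ?_)⟩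
  · exact (Finset.lt_inf_iff ENNReal.coe_lt_top).2 fun i _ => hδ i
  · exact (hh i (hI.mem_toFinset.2 hi)).trans_le (Finset.inf_le (hI.mem_toFinset.2 hi))

/-- The permutation of the Bernoulli space induced by a permutation of the coordinates. -/
def permEquiv (ρ : Equiv.Perm (ℕ × F2)) : BSpace ≃ᵐ BSpace :=
  MeasurableEquiv.piCongrLeft (fun _ => Bool) ρ

theorem permEquiv_apply (ρ : Equiv.Perm (ℕ × F2)) (x : BSpace) (i : ℕ × F2) :
    permEquiv ρ x (ρ i) = x i := by
  rw [permEquiv, MeasurableEquiv.coe_piCongrLeft, Equiv.piCongrLeft_apply_apply]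

/-- The automorphism induced by a permutation of the coordinates. -/
def permAut (ρ : Equiv.Perm (ℕ × F2)) : MAut bernoulliMeas :=
  MAlgIso.ofMeasurableEquiv (permEquiv ρ)
    ⟨(permEquiv ρ).measurable, Measure.infinitePi_map_piCongrLeft (fun _ => coin) ρ⟩

theorem MAlgIso.ofMeasurableEquiv_mk_eq {X : Type u} {Y : Type v} [MeasurableSpace X]
    [MeasurableSpace Y] {μ : Measure X} {ν : Measure Y} (e : X ≃ᵐ Y)
    (he : MeasurePreserving e μ ν) {A : Set X} {B : Set Y} (hA : MeasurableSet A)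
    (hB : MeasurableSet B) (h : ∀ x, e x ∈ B ↔ x ∈ A) :
    MAlgIso.ofMeasurableEquiv e he (MAlg.mk μ A hA) = MAlg.mk ν B hB := by
  have : e '' A = B := by
    ext y
    rw [← e.apply_symm_apply y, e.injective.mem_set_image, h]
  subst this
  rfl

theorem permAut_coordCls (ρ : Equiv.Perm (ℕ × F2)) (i : ℕ × F2) :
    permAut ρ (coordCls i) = coordCls (ρ i) :=
  MAlgIso.ofMeasurableEquiv_mk_eq _ _ _ _ fun x => by
    rw [Set.mem_ofPred_eq, permEquiv_apply]; rfl

theorem shiftAut_coordCls (γ : F2) (i : ℕ × F2) :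
    shiftAut γ (coordCls i) = coordCls (i.1, γ * i.2) :=
  MAlgIso.ofMeasurableEquiv_mk_eq _ _ _ _ fun x => by
    have : shift γ x (i.1, γ * i.2) = x (i.1, γ⁻¹ * (γ * i.2)) := rfl
    rw [Set.mem_ofPred_eq, this, inv_mul_cancel_left]; rfl

/-- For `i ≠ j` the cylinder with `true` at `i` and `false` at `j` has positive measure. -/
theorem coordCls_injective : Function.Injective coordCls := fun i j hij => by
  by_contra hne
  have h : ∀ᵐ x ∂bernoulliMeas, x i = true ↔ x j = true :=
    (MAlg.mk_eq_mk.1 hij).mono fun x hx => Iff.of_eq hx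
  have h0 : bernoulliMeas {x | ∀ k ∈ ({i, j} : Finset (ℕ × F2)), x k = decide (k = i)} = 0 := by
    refine measure_mono_null (fun x hx => ?_) (ae_iff.1 h)
    simp only [Set.mem_ofPred_eq, Finset.mem_insert, Finset.mem_singleton] at hx
    have hi : x i = true := by simpa using hx i (Or.inl rfl)
    have hj : x j = false := by simpa [Ne.symm hne] using hx j (Or.inr rfl)
    simp [hi, hj]
  rw [bernoulliMeas_eq_on] at h0
  simp at h0

/-- Letting a permutation of `{0, 1}^D` act on the coordinates in `D`. -/
def localMap {D : Finset (ℕ × F2)} (σ : Equiv.Perm (D → Bool)) (x : BSpace) : BSpace :=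
  fun i => if h : i ∈ D then σ (D.restrict x) ⟨i, h⟩ else x i

theorem restrict_localMap {D : Finset (ℕ × F2)} (σ : Equiv.Perm (D → Bool)) (x : BSpace) :
    D.restrict (localMap σ x) = σ (D.restrict x) := by
  funext i
  simp [localMap, Finset.restrict]

theorem localMap_apply_of_notMem {D : Finset (ℕ × F2)} (σ : Equiv.Perm (D → Bool)) (x : BSpace)
    {i : ℕ × F2} (hi : i ∉ D) : localMap σ x i = x i := dif_neg hi

theorem localMap_localMap {D : Finset (ℕ × F2)} (σ τ : Equiv.Perm (D → Bool))
    (h : ∀ y, σ (τ y) = y) (x : BSpace) : localMap σ (localMap τ x) = x := by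
  funext i
  by_cases hi : i ∈ D
  · have := restrict_localMap σ (localMap τ x)
    rw [restrict_localMap τ, h] at this
    exact congrFun this ⟨i, hi⟩
  · rw [localMap_apply_of_notMem _ _ hi, localMap_apply_of_notMem _ _ hi]

theorem measurable_localMap {D : Finset (ℕ × F2)} (σ : Equiv.Perm (D → Bool)) :
    Measurable (localMap σ) := by
  refine measurable_pi_iff.2 fun i => ?_
  by_cases hi : i ∈ D
  · simp only [localMap, hi, dif_pos]
    exact (measurable_pi_apply _).comp
      ((measurable_of_finite σ).comp (Finset.measurable_restrict D))
  · simpa only [localMap, hi, dif_neg, not_false_eq_true] using measurable_pi_apply i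

theorem bernoulliMeas_restrict_singleton (D : Finset (ℕ × F2)) (y : D → Bool) :
    bernoulliMeas (D.restrict ⁻¹' {y}) = 2⁻¹ ^ D.card := by
  rw [← bernoulliMeas_eq_on D fun i => if h : i ∈ D then y ⟨i, h⟩ else false]
  congr 1
  ext x
  simp only [Set.mem_preimage, Set.mem_singleton_iff, Set.mem_ofPred_eq, funext_iff]
  refine ⟨fun h i hi => by simpa [hi] using h ⟨i, hi⟩, fun h i => by simpa using h i i.2⟩

theorem bernoulliMeas_restrict (D : Finset (ℕ × F2)) (W : Finset (D → Bool)) :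
    bernoulliMeas (D.restrict ⁻¹' (W : Set (D → Bool))) = W.card * 2⁻¹ ^ D.card := by
  rw [← sum_measure_preimage_singleton W fun y _ =>
    Finset.measurable_restrict D (measurableSet_singleton y)]
  simp [bernoulliMeas_restrict_singleton]

/-- It is enough to test boxes. A box splits into a condition on the coordinates in `D` and an
independent one outside `D`; the map changes only the former, and a permutation of `{0, 1}^D`
preserves the uniform measure there. -/
theorem measurePreserving_localMap {D : Finset (ℕ × F2)} (σ : Equiv.Perm (D → Bool)) :
    MeasurePreserving (localMap σ) bernoulliMeas bernoulliMeas := by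
  classical
  refine ⟨measurable_localMap σ, Measure.eq_infinitePi _ fun s t ht => ?_⟩
  have hcoord : ProbabilityTheory.iIndepFun (fun i (x : BSpace) => x i) bernoulliMeas :=
    ProbabilityTheory.iIndepFun_infinitePi (P := fun _ => coin) (X := fun _ => id)
      fun _ => measurable_id
  have hind := hcoord.indepFun_finset D (s \ D) Finset.disjoint_sdiff fun i => measurable_pi_apply i
  let B : Set (D → Bool) := {y | ∀ i : D, i.1 ∈ s → y i ∈ t i}
  let B' : Set ((s \ D : Finset (ℕ × F2)) → Bool) := {y | ∀ i : (s \ D : Finset (ℕ × F2)), y i ∈ t i}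
  have key : ∀ C : Set (D → Bool),
      bernoulliMeas (D.restrict ⁻¹' C ∩ (s \ D).restrict ⁻¹' B') =
        bernoulliMeas (D.restrict ⁻¹' C) * bernoulliMeas ((s \ D).restrict ⁻¹' B') := fun C =>
    hind.measure_inter_preimage_eq_mul _ _ (Set.toFinite C).measurableSet
      (Set.toFinite B').measurableSet
  have hpi : (s : Set (ℕ × F2)).pi t = D.restrict ⁻¹' B ∩ (s \ D).restrict ⁻¹' B' := by
    ext x
    simp only [Set.mem_pi, Finset.mem_coe, Set.mem_inter_iff, Set.mem_preimage, B, B',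
      Set.mem_ofPred_eq, Finset.restrict, Subtype.forall, Finset.mem_sdiff]
    refine ⟨fun h => ⟨fun i _ hi => h i hi, fun i hi => h i hi.1⟩, fun h i hi => ?_⟩
    by_cases hD : i ∈ D
    · exact h.1 i hD hi
    · exact h.2 i ⟨hi, hD⟩
  have hpre : localMap σ ⁻¹' (s : Set (ℕ × F2)).pi t =
      D.restrict ⁻¹' (σ ⁻¹' B) ∩ (s \ D).restrict ⁻¹' B' := by
    rw [hpi, Set.preimage_inter]
    congr 1
    · ext x
      simp only [Set.mem_preimage, restrict_localMap]
    · ext x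
      have : (s \ D).restrict (localMap σ x) = (s \ D).restrict x := by
        funext i
        exact localMap_apply_of_notMem σ x (Finset.mem_sdiff.1 i.2).2
      simp only [Set.mem_preimage, this]
  have hσ : bernoulliMeas (D.restrict ⁻¹' (σ ⁻¹' B)) = bernoulliMeas (D.restrict ⁻¹' B) := by
    have h1 := bernoulliMeas_restrict D (Finset.univ.filter (· ∈ B))
    have h2 := bernoulliMeas_restrict D (Finset.univ.filter (· ∈ σ ⁻¹' B))
    simp only [Finset.coe_filter, Finset.mem_univ, true_and, Set.ofPred_mem_eq] at h1 h2
    rw [h1, h2]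
    congr 2
    exact Finset.card_bij (fun y _ => σ y) (fun y hy => by simpa using hy)
      (fun _ _ _ _ h => σ.injective h) fun y hy => ⟨σ.symm y, by simpa using hy, by simp⟩
  rw [Measure.map_apply (measurable_localMap σ)
    (MeasurableSet.pi s.countable_toSet fun i _ => ht i), hpre, key, hσ, ← key, ← hpi,
    bernoulliMeas, Measure.infinitePi_pi _ fun i _ => ht i]

/-- The automorphism of the measure algebra given by the inverse image under `localMap σ`. -/
def localAut {D : Finset (ℕ × F2)} (σ : Equiv.Perm (D → Bool)) : MAut bernoulliMeas :=
  MAlgIso.ofMeasurableEquiv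
    -- The inverse map is taken because `ofMeasurableEquiv` acts by direct images.
    { toFun := localMap σ.symm
      invFun := localMap σ
      left_inv := localMap_localMap σ σ.symm σ.apply_symm_apply
      right_inv := localMap_localMap σ.symm σ σ.symm_apply_apply
      measurable_toFun := measurable_localMap σ.symm
      measurable_invFun := measurable_localMap σ } (measurePreserving_localMap σ.symm)

theorem localAut_mk {D : Finset (ℕ × F2)} (σ : Equiv.Perm (D → Bool)) {A : Set BSpace}
    (hA : MeasurableSet A) :
    localAut σ (MAlg.mk bernoulliMeas A hA) =
      MAlg.mk bernoulliMeas (localMap σ ⁻¹' A) (measurable_localMap σ hA) :=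
  MAlgIso.ofMeasurableEquiv_mk_eq _ _ _ _ fun x => by
    change localMap σ (localMap σ.symm x) ∈ A ↔ _
    rw [localMap_localMap _ _ σ.apply_symm_apply]

theorem localAut_coordCls_of_notMem {D : Finset (ℕ × F2)} (σ : Equiv.Perm (D → Bool))
    {i : ℕ × F2} (hi : i ∉ D) : localAut σ (coordCls i) = coordCls i := by
  rw [coordCls, localAut_mk, MAlg.mk_eq_mk]
  refine Filter.Eventually.of_forall fun x => ?_
  change (localMap σ x i = true) = (x i = true)
  rw [localMap_apply_of_notMem σ x hi]

/-! ### Density of the local automorphisms -/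

open Classical in
/-- Two labelings of a finite set agree, after a permutation, up to the differences of the numbers
of points that carry each label. -/
theorem exists_perm_card_ne_le {Ω S : Type*} [Fintype Ω] [Fintype S] (f f' : Ω → S) :
    ∃ σ : Equiv.Perm Ω, (Finset.univ.filter fun ω => f (σ ω) ≠ f' ω).card ≤
      ∑ s, ((Finset.univ.filter fun ω => f' ω = s).card -
        (Finset.univ.filter fun ω => f ω = s).card) := by
  -- A permutation with the largest number of agreements works.
  obtain ⟨σ, -, hσ⟩ := Finset.exists_max_image (Finset.univ : Finset (Equiv.Perm Ω))
    (fun σ => (Finset.univ.filter fun ω => f (σ ω) = f' ω).card) Finset.univ_nonempty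
  refine ⟨σ, ?_⟩
  have hsum : (Finset.univ.filter fun ω => f (σ ω) ≠ f' ω).card =
      ∑ s, (Finset.univ.filter fun ω => f' ω = s ∧ f (σ ω) ≠ s).card := by
    rw [Finset.card_eq_sum_card_fiberwise (f := f') (t := Finset.univ) (by simp)]
    refine Finset.sum_congr rfl fun s _ => congrArg Finset.card ?_
    ext ω
    simp only [Finset.mem_filter, Finset.mem_univ, true_and]
    exact ⟨fun h => ⟨h.2, h.2 ▸ h.1⟩, fun h => ⟨h.1 ▸ h.2, h.1⟩⟩
  rw [hsum]
  refine Finset.sum_le_sum fun s _ => ?_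
  have hcard : (Finset.univ.filter fun ω => f ω = s).card =
      (Finset.univ.filter fun ω => f (σ ω) = s).card :=
    (Finset.card_bij (fun ω _ => σ ω) (by simp) (fun _ _ _ _ h => σ.injective h)
      fun ω hω => ⟨σ.symm ω, by simpa using hω, by simp⟩).symm
  -- Either the fibre of `f ∘ σ` over `s` lies in that of `f'`, and the misses are exactly the
  -- difference, or `s` is also used at some wrong point `ω₂`. In the latter case a miss `ω₁` could
  -- be repaired by swapping it with `ω₂`, against maximality.
  by_cases h : ∀ ω, f (σ ω) = s → f' ω = s
  · rw [hcard, ← Finset.card_sdiff_of_subset fun ω => by simpa using h ω]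
    refine Finset.card_le_card fun ω hω => ?_
    simpa using hω
  · push Not at h
    obtain ⟨ω₂, h2, h2'⟩ := h
    refine (Finset.card_eq_zero.2 (Finset.filter_eq_empty_iff.2 fun ω₁ _ ⟨h1, h1'⟩ => ?_)).trans_le
      (Nat.zero_le _)
    refine absurd (hσ (σ * Equiv.swap ω₁ ω₂) (Finset.mem_univ _)) (not_le.2 ?_)
    refine Finset.card_lt_card (Finset.ssubset_iff_of_subset ?_ |>.2 ⟨ω₁, ?_, ?_⟩)
    · intro ω hω
      simp only [Finset.mem_filter, Finset.mem_univ, true_and] at hω ⊢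
      have hn1 : ω ≠ ω₁ := by rintro rfl; exact h1' (hω.trans h1)
      have hn2 : ω ≠ ω₂ := by rintro rfl; exact h2' (hω.symm.trans h2)
      rw [Equiv.Perm.mul_apply, Equiv.swap_apply_of_ne_of_ne hn1 hn2, hω]
    · rw [Finset.mem_filter, Equiv.Perm.mul_apply, Equiv.swap_apply_left, h2, h1]
      exact ⟨Finset.mem_univ _, rfl⟩
    · simpa [h1] using h1'

/-- An automorphism maps the cylinder sets to the sets given by the same conditions on
representatives of the images of the coordinate classes. -/
theorem map_mk_forall_coord (g : MAut bernoulliMeas) {R : ℕ × F2 → Set BSpace}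
    (hR : ∀ i, MeasurableSet (R i)) (hgR : ∀ i, g (coordCls i) = MAlg.mk bernoulliMeas (R i) (hR i))
    (D : Finset (ℕ × F2)) (y : ℕ × F2 → Bool) :
    ∃ (h : MeasurableSet {x : BSpace | ∀ i ∈ D, x i = y i})
      (h' : MeasurableSet {x : BSpace | ∀ i ∈ D, x ∈ R i ↔ y i = true}),
      g (MAlg.mk bernoulliMeas _ h) = MAlg.mk bernoulliMeas _ h' := by
  classical
  induction D using Finset.induction_on with
  | empty =>
    simp only [Finset.notMem_empty, false_imp_iff, implies_true, Set.ofPred_true]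
    exact ⟨MeasurableSet.univ, MeasurableSet.univ, g.map_full⟩
  | insert j D _ ih =>
    obtain ⟨h, h', hg⟩ := ih
    have e1 : {x : BSpace | ∀ i ∈ insert j D, x i = y i} =
        {x | x j = y j} ∩ {x | ∀ i ∈ D, x i = y i} := by
      ext x; simp
    have e2 : {x : BSpace | ∀ i ∈ insert j D, x ∈ R i ↔ y i = true} =
        {x | x ∈ R j ↔ y j = true} ∩ {x | ∀ i ∈ D, x ∈ R i ↔ y i = true} := by
      ext x; simp
    have hj : ∃ (h : MeasurableSet {x : BSpace | x j = y j})
        (h' : MeasurableSet {x : BSpace | x ∈ R j ↔ y j = true}),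
        g (MAlg.mk bernoulliMeas _ h) = MAlg.mk bernoulliMeas _ h' := by
      cases hy : y j
      · have e1 : {x : BSpace | x j = false} = {x | x j = true}ᶜ := by ext x; simp
        have e2 : {x : BSpace | x ∈ R j ↔ false = true} = (R j)ᶜ := by ext x; simp
        simp only [e1, e2]
        refine ⟨(measurableSet_coord j).compl, (hR j).compl, ?_⟩
        rw [← MAlg.symDiff_full_mk (hA := measurableSet_coord j), g.map_symDiff, g.map_full]
        exact (congrArg (MAlg.symDiff · MAlg.full) (hgR j)).trans MAlg.symDiff_full_mk
      · simp only [iff_true, Set.ofPred_mem_eq]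
        exact ⟨measurableSet_coord j, hR j, hgR j⟩
    obtain ⟨k, k', hk⟩ := hj
    simp only [e1, e2]
    refine ⟨k.inter h, k'.inter h', ?_⟩
    rw [← MAlg.inter_mk (hA := k) (hB := h), g.map_inter, hk, hg, MAlg.inter_mk]

theorem bernoulliMeas_forall_mem_iff (g : MAut bernoulliMeas) {R : ℕ × F2 → Set BSpace}
    (hR : ∀ i, MeasurableSet (R i)) (hgR : ∀ i, g (coordCls i) = MAlg.mk bernoulliMeas (R i) (hR i))
    (D : Finset (ℕ × F2)) (y : ℕ × F2 → Bool) :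
    bernoulliMeas {x : BSpace | ∀ i ∈ D, x ∈ R i ↔ y i = true} = 2⁻¹ ^ D.card := by
  obtain ⟨h, h', hg⟩ := map_mk_forall_coord g hR hgR D y
  rw [← bernoulliMeas_eq_on D y]
  exact (congrArg MAlg.meas hg).symm.trans (g.meas_map _)

open Classical in
/-- Automorphisms are approximated on the coordinate classes by local ones. -/
theorem exists_localAut_edist_lt (g : MAut bernoulliMeas) (D : Finset (ℕ × F2)) {ε : ℝ≥0∞}
    (hε : 0 < ε) : ∃ (D' : Finset (ℕ × F2)) (σ : Equiv.Perm (D' → Bool)), ∀ i ∈ D,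
      edist (localAut σ (coordCls i)) (g (coordCls i)) < ε := by
  choose R hR hgR using fun i => MAlg.exists_mk (g (coordCls i))
  set N : ℝ≥0∞ := ∑ _y : D → Bool, (D.card : ℝ≥0∞) with hN
  have hNtop : N ≠ ∞ := by simp [hN, ENNReal.mul_eq_top]
  -- Each of the labels `y : D → Bool` will contribute at most `D.card * δ` to the mismatch, in
  -- total `N * δ`; the further `δ` pays for replacing `R i` by a cylinder.
  obtain ⟨δ, hδ, hδε⟩ : ∃ δ : ℝ≥0∞, 0 < δ ∧ N * δ + δ < ε := by
    obtain ⟨η, hη0, hηε⟩ := exists_between hε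
    have h1 : N + 1 ≠ ∞ := by simp [hNtop]
    refine ⟨η / (N + 1), ENNReal.div_pos hη0.ne' h1, ?_⟩
    rwa [← add_one_mul, ENNReal.mul_div_cancel (by simp) h1]
  have hC : ∀ i, ∃ C ∈ measurableCylinders fun _ : ℕ × F2 => Bool,
      bernoulliMeas (C ∆ R i) < δ := fun i =>
    exists_measure_symmDiff_lt_of_generateFrom_isSetRing isSetRing_measurableCylinders
      ⟨{Set.univ}, Set.countable_singleton _,
        Set.singleton_subset_iff.2 isSetAlgebra_measurableCylinders.univ_mem, by simp⟩
      generateFrom_measurableCylinders.symm (hR i) hδ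
  choose C hC hCR using hC
  choose s S hS hCs using fun i => (mem_measurableCylinders _).1 (hC i)
  set D' : Finset (ℕ × F2) := D ∪ D.biUnion s
  have hDD' : ∀ i : D, i.1 ∈ D' := fun i => Finset.mem_union_left _ i.2
  have hsD' : ∀ i : D, ∀ k : s i, k.1 ∈ D' := fun i k =>
    Finset.mem_union_right _ (Finset.mem_biUnion.2 ⟨i, i.2, k.2⟩)
  -- A point of `{0, 1}^D'` is labeled by its own coordinates in `D`, and by the pattern of the
  -- cylinders `C i` containing it. Matching the two labelings makes `localAut σ` send coordinate
  -- classes close to those of the `C i`.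
  let f : (D' → Bool) → D → Bool := fun ω i => ω ⟨i, hDD' i⟩
  let f' : (D' → Bool) → D → Bool := fun ω i => decide ((fun k : s i => ω ⟨k, hsD' i k⟩) ∈ S i)
  have hf' : ∀ (x : BSpace) (i : D), f' (D'.restrict x) i = true ↔ x ∈ C i := fun x i => by
    rw [hCs i, mem_cylinder]; exact decide_eq_true_iff
  obtain ⟨σ, hσ⟩ := exists_perm_card_ne_le f f'
  refine ⟨D', σ, fun i hi => ?_⟩
  have hlabel : ∀ y : D → Bool,
      (((Finset.univ.filter fun ω => f' ω = y).card -
        (Finset.univ.filter fun ω => f ω = y).card : ℕ) : ℝ≥0∞) * 2⁻¹ ^ D'.card ≤ D.card * δ := by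
    intro y
    let y' : ℕ × F2 → Bool := fun i => if h : i ∈ D then y ⟨i, h⟩ else false
    have hy' : ∀ i : D, y' i = y i := fun i => by simp [y']
    -- As `g` preserves the measure, the `f`-fibre over `y` is as large as the set with pattern `y`
    -- for the `R i`, which differs from the `f'`-fibre only inside the sets `C i ∆ R i`.
    have h1 : bernoulliMeas (D'.restrict ⁻¹' {ω | f ω = y}) =
        bernoulliMeas {x : BSpace | ∀ i ∈ D, x ∈ R i ↔ y' i = true} := by
      rw [bernoulliMeas_forall_mem_iff g hR hgR, ← bernoulliMeas_eq_on D y']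
      congr 1
      ext x
      simp only [Set.mem_preimage, Set.mem_ofPred_eq, funext_iff]
      exact ⟨fun h i hi => (h ⟨i, hi⟩).trans (hy' ⟨i, hi⟩).symm,
        fun h i => (h i i.2).trans (hy' i)⟩
    have h2 := bernoulliMeas_restrict D' (Finset.univ.filter fun ω => f' ω = y)
    have h3 := bernoulliMeas_restrict D' (Finset.univ.filter fun ω => f ω = y)
    simp only [Finset.coe_filter, Finset.mem_univ, true_and] at h2 h3
    rw [ENNReal.natCast_sub, ENNReal.sub_mul fun _ _ => by simp, ← h2, ← h3, h1]
    refine le_measure_sdiff.trans ?_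
    calc _ ≤ bernoulliMeas (⋃ i ∈ D, C i ∆ R i) := measure_mono fun x hx => ?_
      _ ≤ ∑ i ∈ D, bernoulliMeas (C i ∆ R i) := measure_biUnion_finset_le _ _
      _ ≤ ∑ i ∈ D, δ := Finset.sum_le_sum fun i _ => (hCR i).le
      _ = D.card * δ := by rw [Finset.sum_const, nsmul_eq_mul]
    obtain ⟨hx1, hx2⟩ := hx
    simp only [Set.mem_ofPred_eq, not_forall] at hx2
    obtain ⟨j, hj, hx2⟩ := hx2
    refine Set.mem_biUnion hj ?_
    have h4 : x ∈ C j ↔ y' j = true := by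
      rw [← hf' x ⟨j, hj⟩, hy' ⟨j, hj⟩]
      exact Iff.of_eq (congrArg (· = true) (congrFun hx1 ⟨j, hj⟩))
    rw [← h4] at hx2
    rw [Set.mem_symmDiff]
    tauto
  have hmis : bernoulliMeas (D'.restrict ⁻¹' {ω | f (σ ω) ≠ f' ω}) ≤ N * δ := by
    have h2 := bernoulliMeas_restrict D' (Finset.univ.filter fun ω => f (σ ω) ≠ f' ω)
    simp only [Finset.coe_filter, Finset.mem_univ, true_and] at h2
    have hσ' : (Finset.univ.filter fun ω => f (σ ω) ≠ f' ω).card ≤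
        ∑ y, ((Finset.univ.filter fun ω => f' ω = y).card -
          (Finset.univ.filter fun ω => f ω = y).card) := by convert hσ
    rw [h2]
    refine (mul_le_mul' (Nat.cast_le.2 hσ') le_rfl).trans ?_
    rw [Nat.cast_sum, Finset.sum_mul, hN, Finset.sum_mul]
    exact Finset.sum_le_sum fun y _ => hlabel y
  rw [coordCls, localAut_mk, ← coordCls, hgR i, MAlg.edist_mk]
  refine (measure_symmDiff_le _ (C i) _).trans_lt
    ((add_le_add (le_trans (measure_mono fun x hx => ?_) hmis) (hCR i).le).trans_lt hδε)
  intro heq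
  have h5 : f (σ (D'.restrict x)) ⟨i, hi⟩ = localMap σ x i := by
    rw [← restrict_localMap]; rfl
  have h6 : localMap σ x i = true ↔ x ∈ C i := by
    rw [← h5, heq]; exact hf' x ⟨i, hi⟩
  rw [Set.mem_symmDiff, Set.mem_preimage, Set.mem_ofPred_eq, h6] at hx
  tauto

theorem dense_localAut :
    Dense {g : MAut bernoulliMeas | ∃ D : Finset (ℕ × F2), ∀ i ∉ D, g (coordCls i) = coordCls i} := by
  refine fun g => mem_closure_iff_nhds.2 fun t ht => ?_
  obtain ⟨D, ε, hε, hD⟩ := exists_forall_edist_lt_mem ht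
  obtain ⟨D', σ, hσ⟩ := exists_localAut_edist_lt g D hε
  exact ⟨localAut σ, hD _ hσ, D', fun i hi => localAut_coordCls_of_notMem σ hi⟩

/-! ### Vectors fixed by the stabilizers of finitely many coordinates -/

namespace OrthRep

variable {H : Type v} [NormedAddCommGroup H] [InnerProductSpace ℝ H]

/-- The vector is fixed by all automorphisms that fix the coordinate classes of `F`. -/
def IsFixedBy (π : OrthRep (MAut bernoulliMeas) H) (F : Finset (ℕ × F2)) (ξ : H) : Prop :=
  ∀ g : MAut bernoulliMeas, (∀ i ∈ F, g (coordCls i) = coordCls i) → π.toHom g ξ = ξ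

variable {π : OrthRep (MAut bernoulliMeas) H}

/-- Conjugation by `p⁻¹` carries the stabilizer of the classes of `F.image ρ` into that of the
classes of `F`. -/
theorem IsFixedBy.map [DecidableEq (ℕ × F2)] {F : Finset (ℕ × F2)} {ξ : H}
    (h : π.IsFixedBy F ξ) {p : MAut bernoulliMeas} {ρ : ℕ × F2 → ℕ × F2}
    (hp : ∀ i ∈ F, p (coordCls i) = coordCls (ρ i)) :
    π.IsFixedBy (F.image ρ) (π.toHom p ξ) := fun g hg => by
  have := h (p⁻¹ * g * p) fun i hi => by
    rw [MAut.mul_apply, MAut.mul_apply, hp i hi, hg _ (Finset.mem_image_of_mem ρ hi), ← hp i hi,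
      MAut.inv_apply_apply]
  conv_rhs => rw [← this]
  change _ = (π.toHom p * π.toHom (p⁻¹ * g * p)) ξ
  rw [← map_mul, mul_assoc, mul_inv_cancel_left, map_mul]
  rfl

/-- There are nonzero vectors fixed by the stabilizer of finitely many coordinates. -/
theorem exists_isFixedBy [CompleteSpace H] [Nontrivial H]
    (π : OrthRep (MAut bernoulliMeas) H) : ∃ F, ∃ ξ : H, ξ ≠ 0 ∧ π.IsFixedBy F ξ := by
  obtain ⟨ξ, hξ⟩ := exists_ne (0 : H)
  have hξ' : 0 < ‖ξ‖ := norm_pos_iff.2 hξ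
  -- The radius `‖ξ‖ / 2` keeps `0` out of the closed ball that will contain the hull of the orbit.
  have hU : {g | dist (π.toHom g ξ) ξ < ‖ξ‖ / 2} ∈ 𝓝 (1 : MAut bernoulliMeas) := by
    refine ((π.continuous_apply ξ).dist continuous_const).continuousAt.eventually_lt
      continuousAt_const ?_
    simpa using hξ
  obtain ⟨F, ε, hε, hF⟩ := exists_forall_edist_lt_mem hU
  let G : Set (MAut bernoulliMeas) := {g | ∀ i ∈ F, g (coordCls i) = coordCls i}
  let S : Set H := (fun g => π.toHom g ξ) '' G
  let K : Set H := closure (convexHull ℝ S)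
  have hξS : ξ ∈ S := ⟨1, fun _ _ => rfl, by simp⟩
  have hξK : ξ ∈ K := subset_closure (subset_convexHull ℝ S hξS)
  have hKconv : Convex ℝ K := (convex_convexHull ℝ S).closure
  have hKball : K ⊆ Metric.closedBall ξ (‖ξ‖ / 2) := by
    refine closure_minimal (convexHull_min ?_ (convex_closedBall ξ _)) Metric.isClosed_closedBall
    rintro _ ⟨g, hg, rfl⟩
    have h : dist (π.toHom g ξ) ξ < ‖ξ‖ / 2 := hF g fun i hi => by
      rwa [hg i hi, MAut.one_apply, edist_self]
    exact h.le
  have hKinv : ∀ g ∈ G, ∀ x ∈ K, π.toHom g x ∈ K := by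
    intro g hg x hx
    have hS : (π.toHom g) '' S ⊆ S := by
      rintro _ ⟨_, ⟨k, hk, rfl⟩, rfl⟩
      refine ⟨g * k, fun i hi => ?_, ?_⟩
      · rw [MAut.mul_apply, hk i hi, hg i hi]
      · change π.toHom (g * k) ξ = _
        rw [map_mul]
        rfl
    have h1 : (π.toHom g) '' convexHull ℝ S ⊆ convexHull ℝ S := by
      have := (π.toHom g).toLinearEquiv.toLinearMap.image_convexHull S
      exact (this.subset).trans (convexHull_mono hS)
    have h2 := image_closure_subset_closure_image (π.toHom g).continuous
      (Set.mem_image_of_mem (π.toHom g) hx)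
    exact closure_mono h1 h2
  obtain ⟨v, hvK, hv⟩ := exists_norm_eq_iInf_of_complete_convex ⟨ξ, hξK⟩
    isClosed_closure.isComplete hKconv 0
  rw [norm_eq_iInf_iff_real_inner_le_zero hKconv hvK] at hv
  refine ⟨F, v, ?_, fun g hg => ?_⟩
  · rintro rfl
    have := hKball hvK
    rw [Metric.mem_closedBall, dist_zero_left] at this
    linarith
  · have h := hv _ (hKinv g hg v hvK)
    -- Minimality of `v` gives `‖v‖ ^ 2 ≤ ⟪v, g v⟫`, and `g v` has the same norm as `v`.
    have h1 : ‖π.toHom g v - v‖ ^ 2 ≤ 0 := by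
      rw [zero_sub, inner_neg_left, inner_sub_right, real_inner_self_eq_norm_sq] at h
      rw [norm_sub_sq_real, LinearIsometryEquiv.norm_map, real_inner_comm]
      linarith
    exact sub_eq_zero.1 (norm_eq_zero.1 (pow_eq_zero_iff two_ne_zero |>.1
      (le_antisymm h1 (sq_nonneg _))))

theorem real_inner_map_map (g : MAut bernoulliMeas) (ξ η : H) :
    inner ℝ (π.toHom g ξ) (π.toHom g η) = inner ℝ ξ η := (π.toHom g).inner_map_map ξ η

/-- An injection of a finite set to its complement extends to a permutation that moves only the
points of the set and of its image. -/
theorem _root_.Finset.exists_perm_eq_on {I : Type*} [DecidableEq I] (F : Finset I) (j : I → I)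
    (hj : Set.InjOn j F) (hd : ∀ x ∈ F, j x ∉ F) : ∃ ρ : Equiv.Perm I,
      (∀ x ∈ F, ρ x = j x) ∧ ∀ x ∉ F, (∀ y ∈ F, j y ≠ x) → ρ x = x := by
  induction F using Finset.induction_on with
  | empty => exact ⟨1, by simp, by simp⟩
  | insert a F ha ih =>
    simp only [Finset.mem_insert] at hd
    obtain ⟨ρ, h1, h2⟩ := ih (hj.mono (by simp)) fun x hx h => hd x (Or.inr hx) (Or.inr h)
    have hρa : ρ a = a := h2 a ha fun y hy h => hd y (Or.inr hy) (Or.inl h)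
    refine ⟨Equiv.swap a (j a) * ρ, fun x hx => ?_, fun x hx hy => ?_⟩
    · rw [Equiv.Perm.mul_apply]
      rcases Finset.mem_insert.1 hx with rfl | hxF
      · rw [hρa, Equiv.swap_apply_left]
      · rw [h1 x hxF]
        refine Equiv.swap_apply_of_ne_of_ne (fun h => hd x (Or.inr hxF) (Or.inl h)) fun h => ha ?_
        rwa [← hj (Finset.mem_coe.2 hx) (by simp) h]
    · rw [Finset.mem_insert, not_or] at hx
      rw [Equiv.Perm.mul_apply, h2 x hx.2 fun y h => hy y (Finset.mem_insert_of_mem h)]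
      exact Equiv.swap_apply_of_ne_of_ne hx.1 (hy a (Finset.mem_insert_self a F)).symm

theorem exists_forall_fst_lt (D : Finset (ℕ × F2)) : ∃ N, ∀ i ∈ D, i.1 < N :=
  ⟨D.sup Prod.fst + 1, fun _ hi => Nat.lt_succ_of_le (Finset.le_sup (f := Prod.fst) hi)⟩

/-- Translating the first coordinate by a large `N` moves `F` away from all three finite sets. -/
theorem exists_perm_image_disjoint (E F D : Finset (ℕ × F2)) (hEF : Disjoint E F) :
    ∃ ρ : Equiv.Perm (ℕ × F2), (∀ i ∈ E, ρ i = i) ∧ ∀ i ∈ F, ρ i ∉ D := by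
  classical
  obtain ⟨N, hN⟩ := exists_forall_fst_lt (D ∪ E ∪ F)
  have hN' : ∀ i : ℕ × F2, (i.1 + N, i.2) ∉ D ∪ E ∪ F := fun i hi => by
    have := hN _ hi
    simp at this
  simp only [Finset.mem_union, not_or] at hN'
  obtain ⟨ρ, h1, h2⟩ := F.exists_perm_eq_on (fun i => (i.1 + N, i.2))
    (fun x _ y _ h => by simpa [Prod.ext_iff] using h) fun x _ => (hN' x).2
  exact ⟨ρ, fun i hi => h2 i (Finset.disjoint_left.1 hEF hi) fun y _ h => (hN' y).1.2 (h ▸ hi),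
    fun i hi => h1 i hi ▸ (hN' i).1.1⟩

theorem exists_perm_snd_eq_one (F : Finset (ℕ × F2)) :
    ∃ ρ : Equiv.Perm (ℕ × F2), ∀ i ∈ F, (ρ i).2 = 1 := by
  classical
  obtain ⟨N, hN⟩ := exists_forall_fst_lt F
  obtain ⟨c, hc⟩ := Countable.exists_injective_nat (ℕ × F2)
  -- The fibre over `1` is infinite; adding `N` keeps the targets outside `F`.
  obtain ⟨ρ, h1, -⟩ := F.exists_perm_eq_on (fun i => (c i + N, 1))
    (fun x _ y _ h => hc (by simpa [Prod.ext_iff] using h))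
    fun x _ h => by simpa using hN _ h
  exact ⟨ρ, fun i hi => by rw [h1 i hi]⟩

/-- Vectors fixed by the stabilizers of disjoint sets of coordinates are orthogonal. -/
theorem IsFixedBy.inner_eq_zero [CompleteSpace H] (hπ : ¬ π.HasInvariantVector)
    {E F : Finset (ℕ × F2)} (hEF : Disjoint E F) {ξ η : H} (hξ : π.IsFixedBy E ξ)
    (hη : π.IsFixedBy F η) : inner ℝ ξ η = 0 := by
  classical
  choose ρ hρE hρF using fun D => exists_perm_image_disjoint E F D hEF
  let ζ : Finset (ℕ × F2) → H := fun D => π.toHom (permAut (ρ D)) η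
  have hξζ : ∀ D, inner ℝ ξ (ζ D) = inner ℝ ξ η := fun D => by
    have h : π.toHom (permAut (ρ D)) ξ = ξ := hξ _ fun i hi => by
      rw [permAut_coordCls, hρE D i hi]
    conv_lhs => rw [← h]
    exact real_inner_map_map _ _ _
  have hζ : ∀ D, π.IsFixedBy (F.image (ρ D)) (ζ D) := fun D =>
    hη.map fun i _ => permAut_coordCls _ _
  -- An ultrafilter finer than `atTop` yields a weak limit of the bounded family `ζ` by
  -- Banach–Alaoglu.
  let L : Ultrafilter (Finset (ℕ × F2)) := Ultrafilter.of Filter.atTop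
  have hL : (L : Filter (Finset (ℕ × F2))) ≤ Filter.atTop := Ultrafilter.of_le _
  let φ : Finset (ℕ × F2) → WeakDual ℝ H := fun D =>
    StrongDual.toWeakDual (InnerProductSpace.toDual ℝ H (ζ D))
  have hφ : ∀ D, φ D ∈ WeakDual.toStrongDual ⁻¹' Metric.closedBall 0 ‖η‖ := fun D => by
    change InnerProductSpace.toDual ℝ H (ζ D) ∈ Metric.closedBall 0 ‖η‖
    rw [mem_closedBall_zero_iff, LinearIsometryEquiv.norm_map, LinearIsometryEquiv.norm_map]
  obtain ⟨ℓ, -, hℓ⟩ := (WeakDual.isCompact_closedBall (𝕜 := ℝ) (E := H) 0 ‖η‖).ultrafilter_le_nhds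
    (L.map φ) (Filter.le_principal_iff.2 (Ultrafilter.mem_map.2 (Filter.univ_mem' hφ)))
  have hlim : ∀ x : H, Filter.Tendsto (fun D => inner ℝ (ζ D) x) L (𝓝 (ℓ x)) := fun x =>
    ((WeakDual.eval_continuous x).tendsto ℓ).comp hℓ
  set v := (InnerProductSpace.toDual ℝ H).symm (WeakDual.toStrongDual ℓ) with hv
  have hvx : ∀ x, inner ℝ v x = ℓ x := fun x => InnerProductSpace.toDual_symm_apply
  have hinv : ∀ g, π.toHom g v = v := by
    -- By density it suffices to treat `g` fixing the coordinate classes outside a finite `D₀`. Once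
    -- `D₀ ⊆ D`, the coordinates supporting `ζ D` avoid `D₀`, so `g` fixes `ζ D`.
    have hcl : IsClosed {g | π.toHom g v = v} := isClosed_eq (π.continuous_apply v) continuous_const
    refine fun g => hcl.closure_subset (closure_mono ?_ (dense_localAut g))
    rintro g ⟨D₀, hD₀⟩
    refine ext_inner_right ℝ fun x => ?_
    obtain ⟨y, rfl⟩ := (π.toHom g).surjective x
    rw [real_inner_map_map, hvx, hvx]
    refine tendsto_nhds_unique ((hlim y).congr' ?_) (hlim _)
    filter_upwards [hL (Filter.mem_atTop D₀)] with D hD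
    have h := hζ D g fun i hi => hD₀ i fun hiD => by
      obtain ⟨j, hj, rfl⟩ := Finset.mem_image.1 hi
      exact hρF D j hj (hD hiD)
    conv_rhs => rw [← h]
    exact (real_inner_map_map _ _ _).symm
  have hv0 : v = 0 := by
    by_contra h
    exact hπ ⟨v, h, hinv⟩
  have h1 := hlim ξ
  rw [← hvx, hv0, inner_zero_left] at h1
  refine tendsto_nhds_unique (tendsto_const_nhds.congr fun D => ?_) h1
  rw [real_inner_comm ξ (ζ D), hξζ]

/-- A representation without invariant vectors has a unit vector whose images under the shifts are
pairwise orthogonal. -/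
theorem exists_orthonormal_shiftAut [CompleteSpace H] [Nontrivial H]
    (hπ : ¬ π.HasInvariantVector) :
    ∃ ξ : H, Orthonormal ℝ fun γ : F2 => π.toHom (shiftAut γ) ξ := by
  classical
  obtain ⟨F₀, ξ₀, hξ₀, hF₀⟩ := exists_isFixedBy π
  obtain ⟨ρ, hρ⟩ := exists_perm_snd_eq_one F₀
  set ξ₁ := π.toHom (permAut ρ) ξ₀
  have hξ₁ : ‖ξ₁‖ ≠ 0 := by rwa [LinearIsometryEquiv.norm_map, norm_ne_zero_iff]
  have hF₁ : π.IsFixedBy (F₀.image ρ) ξ₁ := hF₀.map fun i _ => permAut_coordCls ρ i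
  have hfix : ∀ γ : F2, π.IsFixedBy ((F₀.image ρ).image fun i => (i.1, γ * i.2))
      (π.toHom (shiftAut γ) ξ₁) := fun γ => hF₁.map fun i _ => shiftAut_coordCls γ i
  refine ⟨‖ξ₁‖⁻¹ • ξ₁, fun γ => ?_, fun γ δ hγδ => ?_⟩
  · rw [LinearIsometryEquiv.norm_map, norm_smul, norm_inv, norm_norm, inv_mul_cancel₀ hξ₁]
  · beta_reduce
    rw [map_smul, map_smul, inner_smul_left, inner_smul_right,
      IsFixedBy.inner_eq_zero hπ ?_ (hfix γ) (hfix δ), mul_zero, mul_zero]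
    -- The supports lie in the fibres over `γ` and `δ`.
    rw [Finset.disjoint_left]
    intro i hi hi'
    simp only [Finset.mem_image, exists_exists_and_eq_and] at hi hi'
    obtain ⟨a, ha, rfl⟩ := hi
    obtain ⟨b, hb, hab⟩ := hi'
    have := congrArg Prod.snd hab
    simp only [hρ a ha, hρ b hb, mul_one] at this
    exact hγδ this.symm

end OrthRep

/-- An orbit which is an orthonormal family indexed by the group spans a copy of the regular
representation. -/
theorem containsRep_regularRep_of_orthonormal {Γ : Type u} [Group Γ] {H : Type v}
    [NormedAddCommGroup H] [InnerProductSpace ℝ H] [CompleteSpace H] (π : Γ →* (H ≃ₗᵢ[ℝ] H))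
    {ξ : H} (hξ : Orthonormal ℝ fun γ => π γ ξ) : ContainsRep π (regularRep Γ) := by
  refine ⟨hξ.orthogonalFamily.linearIsometry, fun γ f => ?_⟩
  have h1 := hξ.orthogonalFamily.hasSum_linearIsometry (regularRep Γ γ f)
  have h2 := (hξ.orthogonalFamily.hasSum_linearIsometry f).mapL
    (π γ).toContinuousLinearEquiv.toContinuousLinearMap
  -- After reindexing by `g ↦ γ * g` the two series agree term by term.
  rw [← (Equiv.mulLeft γ).hasSum_iff] at h1
  refine h1.unique (h2.congr_fun fun g => ?_)
  have h3 : regularRep Γ γ f (γ * g) = f g := congrArg f (inv_mul_cancel_left γ g)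
  change regularRep Γ γ f (γ * g) • π (γ * g) ξ = π γ (f g • π g ξ)
  rw [h3, map_mul, map_smul]
  rfl

/-! ### The shift action and transport of representations -/

/-- The action of the free group on the measure algebra of the Bernoulli space. -/
def shiftHom : F2 →* MAut bernoulliMeas where
  toFun := shiftAut
  map_one' := MAlgIso.ext fun a => by
    obtain ⟨A, hA, rfl⟩ := MAlg.exists_mk a
    refine MAlgIso.ofMeasurableEquiv_mk_eq _ _ _ _ fun x => Iff.of_eq (congrArg (· ∈ A) ?_)
    funext i
    change x (i.1, 1⁻¹ * i.2) = x i
    rw [inv_one, one_mul]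
  map_mul' γ δ := MAlgIso.ext fun a => by
    obtain ⟨A, hA, rfl⟩ := MAlg.exists_mk a
    refine MAlgIso.ofMeasurableEquiv_mk_eq _ _ _ _ fun x => ?_
    have : shift (γ * δ) x = shift γ (shift δ x) := funext fun i => by
      change x (i.1, (γ * δ)⁻¹ * i.2) = x (i.1, δ⁻¹ * (γ⁻¹ * i.2))
      rw [mul_inv_rev, mul_assoc]
    rw [this, (shift γ).injective.mem_set_image, (shift δ).injective.mem_set_image]

/-- The shift by `γ` sends the class of the coordinate `(0, 1)` to that of `(0, γ)`. -/
theorem shiftHom_injective : Function.Injective shiftHom :=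
  (injective_iff_map_eq_one _).2 fun γ hγ => by
    have h : shiftAut γ (coordCls (0, 1)) = coordCls (0, 1) :=
      DFunLike.congr_fun hγ (coordCls (0, 1))
    rw [shiftAut_coordCls] at h
    simpa using congrArg Prod.snd (coordCls_injective h)

/-- The restriction of an orthogonal representation along a continuous homomorphism. -/
def OrthRep.comap {G : Type u} {K : Type w} [Group G] [TopologicalSpace G] [Group K]
    [TopologicalSpace K] {H : Type v} [NormedAddCommGroup H] [InnerProductSpace ℝ H]
    (π : OrthRep K H) (f : G →* K) (hf : Continuous f) : OrthRep G H where
  toHom := π.toHom.comp f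
  continuous_apply ξ := (π.continuous_apply ξ).comp hf

end

theorem mainTheorem3 :
    Nonempty (MAlgIso bernoulliMeas (volume : Measure unitInterval)) ∧
    ∀ (Φ : MAlgIso bernoulliMeas (volume : Measure unitInterval))
      (T₁ T₂ : MAut (volume : Measure unitInterval)),
      T₁ = MAut.conj Φ (shiftAut (FreeGroup.of 0)) →
      T₂ = MAut.conj Φ (shiftAut (FreeGroup.of 1)) →
      Function.Injective
        (FreeGroup.lift ![T₁, T₂] : F2 →* MAut (volume : Measure unitInterval)) ∧
      ∀ (H : Type*) [NormedAddCommGroup H] [InnerProductSpace ℝ H] [CompleteSpace H]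
        [Nontrivial H] (π : OrthRep (MAut (volume : Measure unitInterval)) H),
        ¬ π.HasInvariantVector →
        ContainsRep (π.toHom.comp (Subgroup.closure {T₁, T₂}).subtype)
          (regularRep (Subgroup.closure {T₁, T₂})) := by
  refine ⟨nonempty_malgIso_unitInterval bernoulliMeas, fun Φ T₁ T₂ hT₁ hT₂ => ?_⟩
  have hlift : (FreeGroup.lift ![T₁, T₂] : F2 →* MAut (volume : Measure unitInterval)) =
      (MAut.conjEquiv Φ).toMonoidHom.comp shiftHom := by
    refine FreeGroup.ext_hom _ _ fun i => ?_
    rw [FreeGroup.lift_apply_of]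
    fin_cases i
    · exact hT₁
    · exact hT₂
  have hinj : Function.Injective
      (FreeGroup.lift ![T₁, T₂] : F2 →* MAut (volume : Measure unitInterval)) := by
    rw [hlift]
    exact (MAut.conjEquiv Φ).injective.comp shiftHom_injective
  refine ⟨hinj, fun H _ _ _ _ π hπ => ?_⟩
  have hrange : (FreeGroup.lift ![T₁, T₂] : F2 →* _).range = Subgroup.closure {T₁, T₂} := by
    rw [FreeGroup.range_lift_eq_closure, Matrix.range_cons_cons_empty]
  obtain ⟨ξ, hξ⟩ := OrthRep.exists_orthonormal_shiftAut
    -- Conjugation is onto, so a vector invariant for the pulled back representation is invariant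
    -- for `π`.
    (π := π.comap (MAut.conjEquiv Φ).toMonoidHom (MAut.continuous_conjEquiv Φ))
    fun ⟨v, hv, hinv⟩ => hπ ⟨v, hv, fun g => by
      obtain ⟨g, rfl⟩ := (MAut.conjEquiv Φ).surjective g
      exact hinv g⟩
  -- Freeness identifies the index set of the orthonormal orbit with the generated subgroup.
  let e : F2 ≃ Subgroup.closure {T₁, T₂} :=
    (Equiv.ofInjective _ hinj).trans (Equiv.setCongr (congrArg SetLike.coe hrange))
  refine containsRep_regularRep_of_orthonormal _ (ξ := ξ) ?_
  convert hξ.comp e.symm e.symm.injective using 1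
  funext γ
  obtain ⟨δ, rfl⟩ := e.surjective γ
  rw [Function.comp_apply, e.symm_apply_apply]
  change π.toHom (FreeGroup.lift ![T₁, T₂] δ) ξ = _
  rw [hlift]
  rfl
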